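/- Let $x_1x_2x_3\dots$ be the binary Ehrenfeucht--Mycielski sequence: it starts $0,1,0$, and each further bit is determined by the bits already written as follows. Find the longest suffix of the current word that has occurred at least once previously in it, take the last previous occurrence of this suffix, and let the next bit be the opposite of the bit following that occurrence. For a binary word $x$, let $N_n(x)$ be the number of (possibly overlapping) occurrences of $x$ in the initial segment $x_1\cdots x_n$. For $n\ge 1$ let $R_n$ be the set of binary words (including the empty word) which occur at least twice in $x_1\cdots x_n$, and let $R_n(x)$ be the set of words in $R_n$ which end in $x$. Let $T_n$ be the tree with vertex set $R_n$, rooted at the empty word, in which $w$ and $aw$ are joined by an edge with label $a$ whenever $a\in\{0,1\}$ and $w,aw\in R_n$; thus the edge labels along the path from a vertex to the root spell the word at that vertex. Let $T_n(x)$ be the subtree of $T_n$ spanned by the vertices whose path to the root has a label word ending in $x$, and let $|T_n(x)|$ be its number of vertices. Then for every fixed binary word $x$, $$|T_n(x)| = |R_n(x)|\quad\text{for all } n\ge 1,\qquad\text{and}\qquad |R_n(x)| = N_n(x)+o(n)\quad\text{as } n\to\infty .$$ -/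

import Mathlib

open Filter Asymptotics

namespace EM

/-- Binary words: `false` is the bit `0`, `true` is the bit `1`. -/
abbrev Word := List Bool

/-- The word `u` occurs in `w` starting at (zero-based) position `i`, that is, right after the
first `i` letters of `w`. Occurrences may overlap. -/
def OccursAt (u w : Word) (i : ℕ) : Prop :=
  i + u.length ≤ w.length ∧ (w.drop i).take u.length = u

instance (u w : Word) (i : ℕ) : Decidable (OccursAt u w i) :=
  inferInstanceAs (Decidable (_ ∧ _))

/-- The number of occurrences of `u` in `w`. -/
def occ (u w : Word) : ℕ :=
  ((Finset.range (w.length + 1)).filter (fun i => OccursAt u w i)).card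

/-- The suffix of `w` of length `k` (for `k ≤ w.length`). -/
def suffixOfLength (w : Word) (k : ℕ) : Word := w.drop (w.length - k)

/-- The length of the longest suffix of `w` that has occurred at least once previously
in `w`, i.e. that has an occurrence starting before the one at the end of `w`. -/
def matchLength (w : Word) : ℕ :=
  Nat.findGreatest (fun k => ∃ i < w.length - k, OccursAt (suffixOfLength w k) w i) w.length

/-- The starting position of the last previous occurrence of that longest suffix. -/
def matchPos (w : Word) : ℕ :=
  Nat.findGreatest
    (fun i => i < w.length - matchLength w ∧ OccursAt (suffixOfLength w (matchLength w)) w i)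
    w.length

/-- The next bit: the opposite of the bit that follows the last previous occurrence of the longest
suffix that has occurred previously. -/
def nextBit (w : Word) : Bool := !(w.getD (matchPos w + matchLength w) false)

/-- The initial segment formed by the first `n` bits of the Ehrenfeucht-Mycielski sequence. The
sequence starts with `0, 1, 0`, and continues by the rule `nextBit`. -/
def initSeg : ℕ → Word
  | 0 => []
  | 1 => [false]
  | 2 => [false, true]
  | 3 => [false, true, false]
  | n + 4 => initSeg (n + 3) ++ [nextBit (initSeg (n + 3))]

theorem length_initSeg : ∀ n : ℕ, (initSeg n).length = n
  | 0 => rfl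
  | 1 => rfl
  | 2 => rfl
  | 3 => rfl
  | n + 4 => by simp [initSeg, length_initSeg (n + 3)]

/-- The number of occurrences of `x` in the first `n` bits of the sequence. -/
def N (n : ℕ) (x : Word) : ℕ := occ x (initSeg n)

/-- The set of words that occur at least twice in the first `n` bits of the sequence. -/
def R (n : ℕ) : Set Word := {u | 2 ≤ occ u (initSeg n)}

/-- The set of words of `R n` that end in `x`. -/
def REnd (n : ℕ) (x : Word) : Set Word := {u | u ∈ R n ∧ x <:+ u}

/-- `R n` is finite, so that the cardinalities below are genuine. -/
theorem finite_R (n : ℕ) : (R n).Finite := by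
  refine (List.finite_length_le Bool n).subset fun u hu => ?_
  have h : 0 < occ u (initSeg n) := lt_of_lt_of_le two_pos hu
  obtain ⟨i, hi⟩ := Finset.card_pos.mp h
  have h2 := (Finset.mem_filter.mp hi).2.1
  rw [length_initSeg] at h2
  show u.length ≤ n
  omega

/-- The tree on the words of `R n`: the root is the empty word, and the vertex `a w` is a child of
the vertex `w` for each bit `a`. -/
def T (n : ℕ) : SimpleGraph (R n) where
  Adj u v := (∃ a : Bool, u.1 = a :: v.1) ∨ (∃ a : Bool, v.1 = a :: u.1)
  symm := ⟨fun _ _ h => h.symm⟩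
  loopless := ⟨fun u h => by
    rcases h with ⟨a, h⟩ | ⟨a, h⟩ <;> simpa using congrArg List.length h⟩

/-- The label of the edge between `a w` and `w` is the bit `a` (in either direction). -/
def edgeLabel (u v : Word) : Bool :=
  if v.length < u.length then u.headD false else v.headD false

/-- The concatenated edge labels along a walk. -/
def labelWord {n : ℕ} {u v : R n} (p : (T n).Walk u v) : Word :=
  p.darts.map fun d => edgeLabel d.fst.1 d.snd.1

/-- The subtree of `T n` ending with `x`: it is spanned by the vertices whose path to the root has
a word of edge labels that ends with `x`. -/
def TEnd (n : ℕ) (x : Word) : (T n).Subgraph :=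
  (⊤ : (T n).Subgraph).induce
    {v | ∃ r : R n, r.1 = [] ∧ ∃ p : (T n).Walk v r, p.IsPath ∧ x <:+ labelWord p}

end EM

/-! The estimate uses one property of the sequence: the first two occurrences of any word are
followed by different bits (`bit_secondOccurrenceFlips`). Hence, within the first `n` bits, every
repeated word of length `k` extends to the right by both bits, except possibly the suffix of length
`k`.

Let F_k(x) and P_k(x) count the words of length `k` ending in `x` that occur, respectively occur
twice. Left extensions give F_{k+1}(x) ≤ F_k(x) + P_k(x). For empty `x`, right extensions give the
reverse up to an error 2. The left deficit of each single word is nonnegative, so a total deficit of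
at most 2 bounds the deficit for every `x` (`card_add_card_repeatedEnding_le`).

If all repeated words are shorter than |x| + r, summing over `k` gives |R_n(x)| = F_{|x|+r}(x) +
O(r) = N_n(x) + O(r). Finally r = o(n) is possible (`length_repeated_lt`): a longer repeated word
has a prefix occurring so often that two occurrences nearly coincide. This prefix has a bounded
period, and its own prefixes force more breaks of that period than `n` bits can hold.

The tree identity holds because path labels spell the starting vertex. -/

namespace EM

/-! ### Factors and their positions -/

/-- The factor of length `k` of the sequence `s` that starts at position `i`. -/
def fac (s : ℕ → Bool) (i k : ℕ) : Word := (List.range' i k).map s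

@[simp] theorem length_fac (s : ℕ → Bool) (i k : ℕ) : (fac s i k).length = k := by simp [fac]

theorem fac_succ (s : ℕ → Bool) (i k : ℕ) : fac s i (k + 1) = s i :: fac s (i + 1) k := by
  simp [fac, List.range'_succ]

theorem fac_concat (s : ℕ → Bool) (i k : ℕ) : fac s i (k + 1) = fac s i k ++ [s (i + k)] := by
  simp [fac, List.range'_concat]

theorem fac_add (s : ℕ → Bool) (i k l : ℕ) :
    fac s i (k + l) = fac s i k ++ fac s (i + k) l := by
  induction l with
  | zero => simp [fac]
  | succ l ih => rw [← add_assoc, fac_concat, ih, fac_concat, add_assoc, List.append_assoc]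

theorem drop_take_fac (s : ℕ → Bool) {n i k : ℕ} (h : i + k ≤ n) :
    ((fac s 0 n).drop i).take k = fac s i k := by
  obtain ⟨r, rfl⟩ := Nat.exists_eq_add_of_le h
  rw [fac_add, fac_add, List.append_assoc, List.drop_left' (by simp), zero_add,
    List.take_left' (by simp)]

theorem fac_eq_fac_iff {s : ℕ → Bool} {i j k : ℕ} :
    fac s i k = fac s j k ↔ ∀ t < k, s (i + t) = s (j + t) := by
  induction k with
  | zero => simp [fac]
  | succ k ih =>
    rw [fac_concat, fac_concat, ← List.concat_eq_append, ← List.concat_eq_append,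
      List.concat_inj, ih]
    constructor
    · rintro ⟨h, h'⟩ t ht
      rcases Nat.lt_succ_iff_lt_or_eq.mp ht with h1 | rfl
      · exact h t h1
      · exact h'
    · exact fun h => ⟨fun t ht => h t (by omega), h k (by omega)⟩

/-- The starting positions of the occurrences of `u` in the first `n` bits of `s`. -/
def positions (s : ℕ → Bool) (n : ℕ) (u : Word) : Finset ℕ :=
  (Finset.range (n + 1)).filter fun i => i + u.length ≤ n ∧ fac s i u.length = u

theorem mem_positions {s : ℕ → Bool} {n i : ℕ} {u : Word} :
    i ∈ positions s n u ↔ i + u.length ≤ n ∧ fac s i u.length = u := by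
  simp only [positions, Finset.mem_filter, Finset.mem_range]
  exact ⟨fun h => h.2, fun h => ⟨by omega, h⟩⟩

theorem fac_mem_positions {s : ℕ → Bool} {n i j k : ℕ} :
    i ∈ positions s n (fac s j k) ↔ i + k ≤ n ∧ fac s i k = fac s j k := by
  simp [mem_positions]

/-! ### The first two occurrences are followed by different bits -/

/-- The bits of the Ehrenfeucht-Mycielski sequence, indexed from `0`. -/
def bit (i : ℕ) : Bool := (initSeg (i + 1)).getD i false

theorem bit_add_three (n : ℕ) : bit (n + 3) = nextBit (initSeg (n + 3)) := by
  show (initSeg (n + 3) ++ [nextBit (initSeg (n + 3))]).getD (n + 3) false = _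
  rw [List.getD_append_right _ _ _ _ (by rw [length_initSeg])]
  simp [length_initSeg]

theorem initSeg_eq_fac : ∀ n : ℕ, initSeg n = fac bit 0 n
  | 0 => rfl
  | 1 => rfl
  | 2 => rfl
  | 3 => rfl
  | n + 4 => by
    rw [fac_concat, ← initSeg_eq_fac (n + 3), zero_add, bit_add_three]
    rfl

theorem occursAt_initSeg_iff {u : Word} {n i : ℕ} :
    OccursAt u (initSeg n) i ↔ i + u.length ≤ n ∧ fac bit i u.length = u := by
  rw [OccursAt, length_initSeg, initSeg_eq_fac]
  exact and_congr_right fun h => by rw [drop_take_fac _ h]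

theorem occ_initSeg (n : ℕ) (u : Word) : occ u (initSeg n) = (positions bit n u).card := by
  simp only [occ, positions, occursAt_initSeg_iff, length_initSeg]

/-- The first two occurrences of any word in `s` are followed by different bits. -/
def SecondOccurrenceFlips (s : ℕ → Bool) : Prop :=
  ∀ i j k : ℕ, i < j → fac s i k = fac s j k →
    (∀ t < j, fac s t k = fac s j k → t = i) → s (i + k) ≠ s (j + k)

theorem suffixOfLength_initSeg {n k : ℕ} (hk : k ≤ n) :
    suffixOfLength (initSeg n) k = fac bit (n - k) k := by
  rw [suffixOfLength, length_initSeg, initSeg_eq_fac,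
    ← drop_take_fac bit (n := n) (i := n - k) (by omega), List.take_of_length_le]
  simp; omega

/-- The next bit is the opposite of the bit following the unique previous occurrence. -/
theorem nextBit_initSeg {n i k : ℕ} (hi : i + k < n) (h : fac bit i k = fac bit (n - k) k)
    (huniq : ∀ t < n - k, fac bit t k = fac bit (n - k) k → t = i) :
    nextBit (initSeg n) = !(bit (i + k)) := by
  set w := initSeg n with hw
  have hlen : w.length = n := length_initSeg n
  have hP : ∃ i < w.length - k, OccursAt (suffixOfLength w k) w i := by
    refine ⟨i, by omega, ?_⟩
    rw [suffixOfLength_initSeg (by omega), hw, occursAt_initSeg_iff]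
    simp only [length_fac]
    exact ⟨by omega, h⟩
  have hkl : k ≤ matchLength w := Nat.le_findGreatest (by omega) hP
  have hM : ∃ i < w.length - matchLength w,
      OccursAt (suffixOfLength w (matchLength w)) w i :=
    Nat.findGreatest_spec (P := fun k => ∃ i < w.length - k, OccursAt (suffixOfLength w k) w i)
      (by omega) hP
  obtain ⟨a, ha, hao⟩ := hM
  have hp : matchPos w < w.length - matchLength w ∧
      OccursAt (suffixOfLength w (matchLength w)) w (matchPos w) :=
    Nat.findGreatest_spec (P := fun i => i < w.length - matchLength w ∧
      OccursAt (suffixOfLength w (matchLength w)) w i) (m := a) (by omega) ⟨ha, hao⟩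
  obtain ⟨hp1, hp2⟩ := hp
  unfold nextBit
  generalize matchLength w = l at *
  generalize matchPos w = p at *
  rw [suffixOfLength_initSeg (by omega), hw, occursAt_initSeg_iff] at hp2
  simp only [length_fac] at hp2
  -- The last `k` letters of the matched occurrence are an earlier occurrence of the suffix of
  -- length `k`, so they start at `i`. Which longest match is chosen is irrelevant.
  have key : p + (l - k) = i := by
    refine huniq _ (by omega) ?_
    rw [fac_eq_fac_iff] at hp2 ⊢
    intro t ht
    have := hp2.2 (l - k + t) (by omega)
    rw [← add_assoc] at this
    rw [this]
    congr 1
    omega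
  have h1 : (initSeg n).getD (p + l) false = bit (p + l) := by
    rw [initSeg_eq_fac, fac, List.getD_eq_getElem _ _ (by simp; omega)]
    simp
  rw [h1]
  congr 2
  omega

theorem bit_secondOccurrenceFlips : SecondOccurrenceFlips bit := by
  intro i j k hij h huniq
  -- The three prescribed bits do not come from the rule and are checked by hand.
  rcases lt_or_ge (j + k) 3 with h3 | h3
  · obtain ⟨hi, hj⟩ | ⟨hi, hj⟩ | ⟨hi, hj, hk⟩ | ⟨hi, hj, hk⟩ : (j = 2 ∧ i = 0) ∨ (j = 2 ∧ i = 1) ∨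
        (j = 1 ∧ i = 0 ∧ k = 0) ∨ (j = 1 ∧ i = 0 ∧ k = 1) := by omega
    · have := huniq 1 (by omega) (by rw [show k = 0 by omega]; rfl)
      omega
    · have := huniq 0 (by omega) (by rw [show k = 0 by omega]; rfl)
      omega
    · subst hi hj hk; decide
    · subst hi hj hk; exact absurd h (by decide)
  · obtain ⟨n, hn⟩ := Nat.exists_eq_add_of_le' h3
    have hnj : n + 3 - k = j := by omega
    rw [hn, bit_add_three, nextBit_initSeg (i := i) (k := k) (by omega) (by rw [hnj, h])
      (by rw [hnj]; exact huniq)]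
    simp

/-- Among the occurrences of a word up to its occurrence at `j`, the first two are followed by
different bits. -/
theorem SecondOccurrenceFlips.exists_first_two {s : ℕ → Bool} (hs : SecondOccurrenceFlips s)
    {i j k : ℕ} (hij : i < j) (h : fac s i k = fac s j k) :
    ∃ a b, a < b ∧ b ≤ j ∧ fac s a k = fac s j k ∧ fac s b k = fac s j k ∧
      s (a + k) ≠ s (b + k) ∧ ∀ t < b, fac s t k = fac s j k → t = a := by
  classical
  have h1 : ∃ a, fac s a k = fac s j k := ⟨i, h⟩
  have hai : Nat.find h1 ≤ i := Nat.find_min' h1 h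
  have h2 : ∃ b, Nat.find h1 < b ∧ fac s b k = fac s j k := ⟨j, by omega, rfl⟩
  have hb := Nat.find_spec h2
  have hu : ∀ t < Nat.find h2, fac s t k = fac s j k → t = Nat.find h1 := by
    intro t ht htk
    have := Nat.find_min h2 ht
    have := Nat.find_min' h1 htk
    by_contra hne
    exact Nat.find_min h2 ht ⟨by omega, htk⟩
  refine ⟨Nat.find h1, Nat.find h2, hb.1, Nat.find_min' h2 ⟨by omega, rfl⟩, Nat.find_spec h1,
    hb.2, hs _ _ _ hb.1 ((Nat.find_spec h1).trans hb.2.symm) ?_, hu⟩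
  intro t ht htk
  exact hu t ht (htk.trans hb.2)

/-- A word with two occurrences, the second of which is followed by a further bit, occurs with
both possible continuations. -/
theorem SecondOccurrenceFlips.exists_continuation {s : ℕ → Bool} (hs : SecondOccurrenceFlips s)
    {i j k : ℕ} (hij : i < j) (h : fac s i k = fac s j k) (c : Bool) :
    ∃ a ≤ j, fac s a k = fac s j k ∧ s (a + k) = c := by
  obtain ⟨a, b, hab, hbj, ha, hb, hne, -⟩ := hs.exists_first_two hij h
  by_cases hc : s (a + k) = c
  · exact ⟨a, by omega, ha, hc⟩
  · refine ⟨b, hbj, hb, ?_⟩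
    revert hne hc
    cases s (a + k) <;> cases s (b + k) <;> cases c <;> simp

theorem exists_lt_of_two_le_card {S : Finset ℕ} (h : 2 ≤ S.card) :
    ∃ i ∈ S, ∃ j ∈ S, i < j := by
  obtain ⟨a, ha, b, hb, hab⟩ := Finset.one_lt_card.mp h
  rcases lt_or_gt_of_ne hab with h | h
  · exact ⟨a, ha, b, hb, h⟩
  · exact ⟨b, hb, a, ha, h⟩

theorem mem_positions_of_concat {s : ℕ → Bool} {n i : ℕ} {u : Word} {c : Bool}
    (h : i ∈ positions s n (u ++ [c])) :
    i + u.length + 1 ≤ n ∧ fac s i u.length = u ∧ s (i + u.length) = c := by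
  rw [mem_positions] at h
  simp only [List.length_append, List.length_singleton, fac_concat] at h
  obtain ⟨h1, h2⟩ := h
  obtain ⟨h3, h4⟩ := List.append_inj' h2 rfl
  exact ⟨by omega, h3, by simpa using h4⟩

/-- Some occurrence of `u` is followed by the other bit, and it lies early enough to fit in the
first `n` bits. -/
theorem SecondOccurrenceFlips.card_positions_concat_lt {s : ℕ → Bool}
    (hs : SecondOccurrenceFlips s) {n : ℕ} {u : Word} {c : Bool}
    (h : 2 ≤ (positions s n (u ++ [c])).card) :
    (positions s n (u ++ [c])).card < (positions s n u).card := by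
  obtain ⟨i, hi, j, hj, hij⟩ := exists_lt_of_two_le_card h
  have hi' := mem_positions_of_concat hi
  have hj' := mem_positions_of_concat hj
  obtain ⟨a, haj, ha, hac⟩ := hs.exists_continuation hij (hi'.2.1.trans hj'.2.1.symm) (!c)
  refine Finset.card_lt_card (Finset.ssubset_iff_subset_ne.mpr ⟨fun t ht => ?_, fun heq => ?_⟩)
  · have ht' := mem_positions_of_concat ht
    exact mem_positions.mpr ⟨by omega, ht'.2.1⟩
  · have hmem : a ∈ positions s n u := mem_positions.mpr ⟨by omega, ha.trans hj'.2.1⟩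
    rw [← heq] at hmem
    have := (mem_positions_of_concat hmem).2.2
    rw [hac] at this
    cases c <;> simp at this

theorem SecondOccurrenceFlips.card_positions_append {s : ℕ → Bool}
    (hs : SecondOccurrenceFlips s) {n : ℕ} {u : Word} (v : Word)
    (h : 2 ≤ (positions s n (u ++ v)).card) :
    (positions s n (u ++ v)).card + v.length ≤ (positions s n u).card := by
  induction v generalizing u with
  | nil => simp
  | cons c v ih =>
    rw [List.append_cons] at h ⊢
    have h1 := ih h
    have h2 := hs.card_positions_concat_lt (u := u) (c := c) (n := n) (by omega)
    simp only [List.length_cons]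
    omega

/-! ### Breaks of a period and the longest repeated word -/

/-- If a repeated factor has period `q`, then the first or the second occurrence of each of its
proper prefixes of length at least `q` is followed by a break of the period. -/
theorem SecondOccurrenceFlips.exists_break {s : ℕ → Bool} (hs : SecondOccurrenceFlips s)
    {i j k q m : ℕ} (hij : i < j) (h : fac s i k = fac s j k) (hq : q ≠ 0) (hqm : q ≤ m)
    (hmk : m < k) (hper : ∀ t, t + q < k → s (i + t) = s (i + t + q)) :
    ∃ a, a ≤ j ∧ fac s a m = fac s i m ∧ s (a + m) ≠ s (a + m - q) ∧
      ∀ t t', t < t' → t' < a → fac s t m = fac s i m → fac s t' m ≠ fac s i m := by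
  rw [fac_eq_fac_iff] at h
  have hm : fac s i m = fac s j m := fac_eq_fac_iff.mpr fun t ht => h t (by omega)
  obtain ⟨a, b, hab, hbj, ha, hb, hne, hu⟩ := hs.exists_first_two hij hm
  rw [← hm] at ha hb hu
  -- The letter that the period predicts after any occurrence is `s (i + m)`; of the two different
  -- continuations, one violates it.
  have hback : ∀ a, fac s a m = fac s i m → s (a + m - q) = s (i + m) := by
    intro a ha
    have := fac_eq_fac_iff.mp ha (m - q) (by omega)
    rw [hper (m - q) (by omega), ← Nat.add_sub_assoc hqm] at this
    rw [this]
    congr 1; omega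
  by_cases hc : s (a + m) = s (i + m)
  · refine ⟨b, hbj, hb, ?_, ?_⟩
    · rw [hback b hb, ← hc]; exact hne.symm
    · intro t t' htt' ht' h1 h2
      have := hu t (by omega) h1
      have := hu t' ht' h2
      omega
  · refine ⟨a, by omega, ha, ?_, ?_⟩
    · rw [hback a ha]; exact hc
    · intro t t' htt' ht' h1 h2
      have := hu t (by omega) h1
      have := hu t' (by omega) h2
      omega

theorem le_div_add_one_of_separated {n d T : ℕ} (e : ℕ → ℕ) (hd : 0 < d)
    (he : ∀ t < T, e t ≤ n)
    (hsep : ∀ t t', t < t' → t' < T → e t + d ≤ e t' ∨ e t' + d ≤ e t) : T ≤ n / d + 1 := by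
  have hinj : Set.InjOn (fun t => e t / d) (Finset.range T : Finset ℕ) := by
    have key : ∀ t t', t < t' → t' < T → e t / d ≠ e t' / d := by
      intro t t' h h' heq
      rcases hsep t t' h h' with h1 | h1
      · have := Nat.div_le_div_right (c := d) h1
        rw [Nat.add_div_right _ hd] at this
        omega
      · have := Nat.div_le_div_right (c := d) h1
        rw [Nat.add_div_right _ hd] at this
        omega
    intro t ht t' ht' heq
    simp only [Finset.coe_range, Set.mem_Iio] at ht ht'
    rcases lt_trichotomy t t' with h | h | h
    · exact absurd heq (key t t' h ht')
    · exact h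
    · exact absurd heq.symm (key t' t h ht)
  have := Finset.card_le_card_of_injOn (t := Finset.range (n / d + 1)) _ (fun t ht => by
    simp only [Finset.coe_range, Set.mem_Iio] at ht ⊢
    exact Nat.lt_succ_of_le (Nat.div_le_div_right (he t ht))) hinj
  simpa using this

/-- A repeated factor of length `2 * h` with a period `q` forces many well-separated breaks of the
period, which need room. -/
theorem SecondOccurrenceFlips.le_of_periodic {s : ℕ → Bool} (hs : SecondOccurrenceFlips s)
    {n i j h q T : ℕ} (hij : i < j) (hjn : j ≤ n) (hfac : fac s i (2 * h) = fac s j (2 * h))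
    (hq : q ≠ 0) (hqh : q < h) (hT : 2 * q * T ≤ h)
    (hper : ∀ t, t + q < 2 * h → s (i + t) = s (i + t + q)) :
    T ≤ (n + 2 * h) / (h - q) + 1 := by
  have hlt : ∀ t < T, h + 2 * q * t < 2 * h := by
    intro t ht
    have : 2 * q * (t + 1) ≤ 2 * q * T := Nat.mul_le_mul_left _ ht
    rw [mul_add] at this
    omega
  have hex : ∀ t, ∃ a, t < T → a ≤ j ∧
      fac s a (h + 2 * q * t) = fac s i (h + 2 * q * t) ∧
      s (a + (h + 2 * q * t)) ≠ s (a + (h + 2 * q * t) - q) ∧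
      ∀ r r', r < r' → r' < a → fac s r (h + 2 * q * t) = fac s i (h + 2 * q * t) →
        fac s r' (h + 2 * q * t) ≠ fac s i (h + 2 * q * t) := by
    intro t
    by_cases ht : t < T
    · obtain ⟨a, ha⟩ := hs.exists_break hij hfac hq (by omega) (hlt t ht) hper
      exact ⟨a, fun _ => ha⟩
    · exact ⟨0, fun h => absurd h ht⟩
  choose a ha using hex
  have hperiod : ∀ t < T, ∀ r, a t ≤ r → r + q < a t + (h + 2 * q * t) → s r = s (r + q) := by
    intro t ht r h1 h2
    obtain ⟨-, hf, -, -⟩ := ha t ht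
    rw [fac_eq_fac_iff] at hf
    have e1 := hf (r - a t) (by omega)
    have e2 := hf (r - a t + q) (by omega)
    have e3 := hper (r - a t) (by have := hlt t ht; omega)
    rw [show a t + (r - a t) = r by omega] at e1
    rw [show a t + (r - a t + q) = r + q by omega] at e2
    rw [e1, e2, e3, add_assoc]
  -- The earlier break cannot lie `q` or more letters into the periodic run that ends at the later
  -- one.
  have hbreak : ∀ t < T, ∀ t' < T, a t + (h + 2 * q * t) < a t' + (h + 2 * q * t') →
      a t + (h + 2 * q * t) + (h - q) ≤ a t' + (h + 2 * q * t') := by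
    intro t ht t' ht' hlt
    by_contra hcon
    have := hperiod t' ht' (a t + (h + 2 * q * t) - q) (by omega) (by omega)
    rw [show a t + (h + 2 * q * t) - q + q = a t + (h + 2 * q * t) by omega] at this
    exact (ha t ht).2.2.1 this.symm
  refine le_div_add_one_of_separated (fun t => a t + (h + 2 * q * t)) (by omega) (fun t ht => ?_)
    fun t t' htt' ht' => ?_
  · have := (ha t ht).1
    have := hlt t ht
    omega
  · rcases lt_trichotomy (a t + (h + 2 * q * t)) (a t' + (h + 2 * q * t')) with hh | hh | hh
    · exact Or.inl (hbreak t (by omega) t' ht' hh)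
    · exfalso
      -- If two breaks coincide, the run of `t'` is longer by at least `2 * q`. Shifting back by `q`
      -- and `2 * q` gives two earlier occurrences of the shorter prefix, which contradicts that `a
      -- t` is its first or second.
      have hm : 2 * q * (t + 1) ≤ 2 * q * t' := Nat.mul_le_mul_left _ htt'
      rw [mul_add] at hm
      obtain ⟨-, hf, -, hu⟩ := ha t (by omega)
      have hp := hperiod t' ht'
      rw [← hh] at hp
      have h1 : fac s (a t - q) (h + 2 * q * t) = fac s i (h + 2 * q * t) := by
        rw [← hf, fac_eq_fac_iff]
        intro r hr
        rw [hp _ (by omega) (by omega)]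
        congr 1
        omega
      have h2 : fac s (a t - q - q) (h + 2 * q * t) = fac s i (h + 2 * q * t) := by
        rw [← h1, fac_eq_fac_iff]
        intro r hr
        rw [hp _ (by omega) (by omega)]
        congr 1
        omega
      exact hu (a t - q - q) (a t - q) (by omega) (by omega) h2 h1
    · exact Or.inr (hbreak t' ht' t (by omega) hh)

/-- If a word occurs more often than there are intervals of length `Q` up to `n`, then two of its
occurrences have distance less than `Q`. -/
theorem exists_close_positions {s : ℕ → Bool} {n Q : ℕ} {u : Word} (hQ : 0 < Q)
    (h : n / Q + 1 < (positions s n u).card) :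
    ∃ i ∈ positions s n u, ∃ j ∈ positions s n u, i < j ∧ j < i + Q := by
  have key : ∃ i ∈ positions s n u, ∃ j ∈ positions s n u, i ≠ j ∧ i / Q = j / Q := by
    refine Finset.exists_ne_map_eq_of_card_lt_of_maps_to (t := Finset.range (n / Q + 1))
      (by simpa using h) fun i hi => ?_
    have := (mem_positions.mp hi).1
    simp only [Finset.coe_range, Set.mem_Iio]
    exact Nat.lt_succ_of_le (Nat.div_le_div_right (by omega))
  obtain ⟨i, hi, j, hj, hij, heq⟩ := key
  have h1 := Nat.div_add_mod i Q
  have h2 := Nat.div_add_mod j Q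
  have h3 := Nat.mod_lt i hQ
  have h4 := Nat.mod_lt j hQ
  rw [heq] at h1
  rcases lt_or_gt_of_ne hij with h | h
  · exact ⟨i, hi, j, hj, h, by omega⟩
  · exact ⟨j, hj, i, hi, h, by omega⟩

/-- The longest repeated word has length `o(n)`. -/
theorem SecondOccurrenceFlips.length_repeated_lt {s : ℕ → Bool} (hs : SecondOccurrenceFlips s)
    {D n : ℕ} (hD : 0 < D) (hn : 8 * D * (16 * D + 8) ≤ n / (4 * D)) {v : Word}
    (hv : 2 ≤ (positions s n v).card) : v.length < 4 * (n / (4 * D)) := by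
  by_contra hcon
  push Not at hcon
  set h := n / (4 * D) with hh
  set u := v.take (2 * h) with hu
  have hul : u.length = 2 * h := by rw [hu, List.length_take]; omega
  have hcard := hs.card_positions_append (s := s) (n := n) (u := u) (v.drop (2 * h))
    (by rwa [hu, List.take_append_drop])
  rw [hu, List.take_append_drop, List.length_drop, ← hu] at hcard
  have hD' : 1 ≤ 8 * D * (16 * D + 8) := by nlinarith
  -- Each letter cut from the end of `v` gains an occurrence, so `u` occurs at least `2 * h + 2`
  -- times, against `h + 1` blocks of length `4 * D`.
  obtain ⟨i, hi, j, hj, hij, hjQ⟩ := exists_close_positions (s := s) (n := n) (Q := 4 * D) (u := u)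
    (by omega) (by omega)
  rw [mem_positions, hul] at hi hj
  have hfac : fac s i (2 * h) = fac s j (2 * h) := hi.2.trans hj.2.symm
  have hbig : 8 * D ≤ h := by nlinarith
  have hn' : n < 4 * D * (h + 1) := by
    have := Nat.lt_div_mul_add (a := n) (b := 4 * D) (by omega)
    rw [← hh] at this
    nlinarith
  have hle := hs.le_of_periodic (n := n) (q := j - i) (T := 16 * D + 8) hij (by omega) hfac
    (by omega) (by omega) (by
      have : 2 * (j - i) ≤ 8 * D := by omega
      exact (Nat.mul_le_mul_right _ this).trans hn) (by
      intro t ht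
      have := (fac_eq_fac_iff.mp hfac) t (by omega)
      rw [this]
      congr 1; omega)
  have hlt : (n + 2 * h) / (h - (j - i)) < 16 * D + 7 := by
    rw [Nat.div_lt_iff_lt_mul (by omega)]
    have h2 : h ≤ 2 * (h - (j - i)) := by omega
    nlinarith
  omega

/-! ### Counting factors by left and right extensions -/

/-- The words of length `k` that end in `x` and occur in the first `n` bits of `s`. -/
def factorsEnding (s : ℕ → Bool) (n : ℕ) (x : Word) (k : ℕ) : Finset Word :=
  ((Finset.range (n + 1 - k)).image fun i => fac s i k).filter fun u => x <:+ u

/-- The words of length `k` that end in `x` and occur at least twice in the first `n` bits. -/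
def repeatedEnding (s : ℕ → Bool) (n : ℕ) (x : Word) (k : ℕ) : Finset Word :=
  (factorsEnding s n x k).filter fun u => 2 ≤ (positions s n u).card

theorem mem_factorsEnding {s : ℕ → Bool} {n k : ℕ} {x u : Word} :
    u ∈ factorsEnding s n x k ↔ (∃ i, i + k ≤ n ∧ fac s i k = u) ∧ x <:+ u := by
  simp only [factorsEnding, Finset.mem_filter, Finset.mem_image, Finset.mem_range]
  refine and_congr_left fun _ => exists_congr fun i => and_congr_left fun _ => ?_
  omega

theorem length_of_mem_factorsEnding {s : ℕ → Bool} {n k : ℕ} {x u : Word}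
    (h : u ∈ factorsEnding s n x k) : u.length = k := by
  obtain ⟨⟨i, -, rfl⟩, -⟩ := mem_factorsEnding.mp h
  simp

theorem mem_repeatedEnding {s : ℕ → Bool} {n k : ℕ} {x u : Word} :
    u ∈ repeatedEnding s n x k ↔
      u.length = k ∧ x <:+ u ∧ 2 ≤ (positions s n u).card := by
  rw [repeatedEnding, Finset.mem_filter]
  constructor
  · exact fun h => ⟨length_of_mem_factorsEnding h.1, (mem_factorsEnding.mp h.1).2, h.2⟩
  · rintro ⟨rfl, hx, h2⟩
    obtain ⟨i, hi⟩ := Finset.card_pos.mp (by omega : 0 < (positions s n u).card)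
    exact ⟨mem_factorsEnding.mpr ⟨⟨i, mem_positions.mp hi⟩, hx⟩, h2⟩

theorem tail_mem_factorsEnding {s : ℕ → Bool} {n k : ℕ} {x u : Word} (hx : x.length ≤ k)
    (h : u ∈ factorsEnding s n x (k + 1)) : u.tail ∈ factorsEnding s n x k := by
  obtain ⟨⟨i, hi, rfl⟩, h2⟩ := mem_factorsEnding.mp h
  rw [fac_succ] at h2 ⊢
  refine mem_factorsEnding.mpr ⟨⟨i + 1, by omega, rfl⟩, ?_⟩
  rcases List.suffix_cons_iff.mp h2 with rfl | h2
  · simp at hx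
  · exact h2

/-- The number of occurring words that extend `v` by a bit on the left. -/
def leftDegree (s : ℕ → Bool) (n : ℕ) (v : Word) : ℕ :=
  ((factorsEnding s n [] (v.length + 1)).filter fun u => u.tail = v).card

/-- Distinct left extensions need distinct occurrences of `v`. -/
theorem leftDegree_le {s : ℕ → Bool} {n : ℕ} {v : Word} :
    leftDegree s n v ≤ 1 + if 2 ≤ (positions s n v).card then 1 else 0 := by
  have hpos : ∀ i a, i + (v.length + 1) ≤ n → fac s i (v.length + 1) = a :: v →
      i + 1 ∈ positions s n v ∧ s i = a := by
    intro i a hi h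
    rw [fac_succ, List.cons.injEq] at h
    exact ⟨mem_positions.mpr ⟨by omega, h.2⟩, h.1⟩
  have hmem : ∀ u ∈ (factorsEnding s n [] (v.length + 1)).filter (fun u => u.tail = v),
      ∃ a, u = a :: v ∧ ∃ i, i + 1 ∈ positions s n v ∧ s i = a := by
    intro u hu
    obtain ⟨hu, ht⟩ := Finset.mem_filter.mp hu
    obtain ⟨⟨i, hi, rfl⟩, -⟩ := mem_factorsEnding.mp hu
    have h : fac s i (v.length + 1) = s i :: v := by
      rw [← ht]; simp [fac_succ]
    exact ⟨s i, h, i, hpos i _ hi h⟩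
  split_ifs with h2
  · calc leftDegree s n v ≤ ({true :: v, false :: v} : Finset Word).card := by
          refine Finset.card_le_card fun u hu => ?_
          obtain ⟨a, rfl, -⟩ := hmem u hu
          cases a <;> simp
      _ ≤ 1 + 1 := Finset.card_le_two
  · refine Finset.card_le_one.mpr fun u hu u' hu' => ?_
    obtain ⟨a, rfl, i, hi, hia⟩ := hmem u hu
    obtain ⟨a', rfl, i', hi', hia'⟩ := hmem u' hu'
    have := Finset.card_le_one.mp (by omega : (positions s n v).card ≤ 1) _ hi _ hi'
    rw [← hia, ← hia', show i = i' by omega]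

theorem card_factorsEnding_succ {s : ℕ → Bool} {n k : ℕ} {x : Word} (hx : x.length ≤ k) :
    (factorsEnding s n x (k + 1)).card = ∑ v ∈ factorsEnding s n x k, leftDegree s n v := by
  rw [Finset.card_eq_sum_card_fiberwise (f := List.tail) (t := factorsEnding s n x k)
    fun u hu => tail_mem_factorsEnding hx hu]
  refine Finset.sum_congr rfl fun v hv => ?_
  have hxv := (mem_factorsEnding.mp hv).2
  rw [leftDegree, length_of_mem_factorsEnding hv]
  congr 1
  ext u
  simp only [Finset.mem_filter, mem_factorsEnding, List.nil_suffix, and_true]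
  refine and_congr_left fun h => and_iff_left_of_imp fun _ => ?_
  rw [← h] at hxv
  exact hxv.trans (List.tail_suffix u)

/-- The number of occurring words that extend `v` by a bit on the right. -/
def rightDegree (s : ℕ → Bool) (n : ℕ) (v : Word) : ℕ :=
  ((factorsEnding s n [] (v.length + 1)).filter fun u => u.dropLast = v).card

theorem card_factorsEnding_nil_succ (s : ℕ → Bool) (n k : ℕ) :
    (factorsEnding s n [] (k + 1)).card = ∑ v ∈ factorsEnding s n [] k, rightDegree s n v := by
  rw [Finset.card_eq_sum_card_fiberwise (f := List.dropLast) (t := factorsEnding s n [] k)]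
  · refine Finset.sum_congr rfl fun v hv => ?_
    rw [rightDegree, length_of_mem_factorsEnding hv]
  · intro u hu
    obtain ⟨⟨i, hi, rfl⟩, -⟩ := mem_factorsEnding.mp hu
    exact mem_factorsEnding.mpr ⟨⟨i, by omega, by simp [fac_concat]⟩, List.nil_suffix⟩

theorem SecondOccurrenceFlips.le_rightDegree {s : ℕ → Bool} (hs : SecondOccurrenceFlips s)
    {n k : ℕ} {v : Word} (hv : v ∈ factorsEnding s n [] k) (hne : v ≠ fac s (n - k) k) :
    (1 + if 2 ≤ (positions s n v).card then 1 else 0) ≤ rightDegree s n v := by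
  obtain ⟨⟨r, hr, rfl⟩, -⟩ := mem_factorsEnding.mp hv
  have hlt : ∀ i ∈ positions s n (fac s r k), i + k < n := by
    intro i hi
    rw [fac_mem_positions] at hi
    refine lt_of_le_of_ne hi.1 fun h => hne ?_
    rw [← hi.2, show i = n - k by omega]
  have hmem : ∀ i ∈ positions s n (fac s r k), fac s r k ++ [s (i + k)] ∈
      (factorsEnding s n [] ((fac s r k).length + 1)).filter fun u => u.dropLast = fac s r k := by
    intro i hi
    have := hlt i hi
    rw [length_fac, Finset.mem_filter, mem_factorsEnding]
    refine ⟨⟨⟨i, by omega, ?_⟩, List.nil_suffix⟩, by simp⟩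
    rw [fac_concat, (fac_mem_positions.mp hi).2]
  have hr' : r ∈ positions s n (fac s r k) := fac_mem_positions.mpr ⟨hr, rfl⟩
  split_ifs with h2
  · obtain ⟨i, hi, j, hj, hij⟩ := exists_lt_of_two_le_card h2
    have hi' := (fac_mem_positions.mp hi).2
    have hj' := fac_mem_positions.mp hj
    have hc : ∀ c, ∃ a ∈ positions s n (fac s r k), s (a + k) = c := by
      intro c
      obtain ⟨a, haj, ha, hac⟩ := hs.exists_continuation hij (hi'.trans hj'.2.symm) c
      exact ⟨a, fac_mem_positions.mpr ⟨by omega, ha.trans hj'.2⟩, hac⟩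
    obtain ⟨a, ha, hat⟩ := hc true
    obtain ⟨b, hb, hbf⟩ := hc false
    refine Finset.one_lt_card.mpr ⟨_, hmem a ha, _, hmem b hb, ?_⟩
    rw [hat, hbf]
    simp
  · exact Finset.card_pos.mpr ⟨_, hmem r hr'⟩

theorem card_factorsEnding_add_card_repeatedEnding (s : ℕ → Bool) (n : ℕ) (x : Word) (k : ℕ) :
    (factorsEnding s n x k).card + (repeatedEnding s n x k).card =
      ∑ v ∈ factorsEnding s n x k, (1 + if 2 ≤ (positions s n v).card then 1 else 0) := by
  rw [Finset.sum_add_distrib, Finset.sum_boole, repeatedEnding]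
  simp

theorem card_factorsEnding_succ_le {s : ℕ → Bool} {n k : ℕ} {x : Word} (hx : x.length ≤ k) :
    (factorsEnding s n x (k + 1)).card ≤
      (factorsEnding s n x k).card + (repeatedEnding s n x k).card := by
  rw [card_factorsEnding_succ hx, card_factorsEnding_add_card_repeatedEnding]
  exact Finset.sum_le_sum fun v _ => leftDegree_le

/-- Only the suffix of length `k` can lack right extensions, and it lacks at most 2. -/
theorem SecondOccurrenceFlips.card_add_card_repeatedEnding_nil_le {s : ℕ → Bool}
    (hs : SecondOccurrenceFlips s) (n k : ℕ) :
    (factorsEnding s n [] k).card + (repeatedEnding s n [] k).card ≤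
      (factorsEnding s n [] (k + 1)).card + 2 := by
  rw [card_factorsEnding_nil_succ, card_factorsEnding_add_card_repeatedEnding]
  calc _ ≤ ∑ v ∈ factorsEnding s n [] k,
        (rightDegree s n v + if v = fac s (n - k) k then 2 else 0) := by
        refine Finset.sum_le_sum fun v hv => ?_
        by_cases h : v = fac s (n - k) k
        · rw [if_pos h]; split_ifs <;> omega
        · rw [if_neg h]; exact hs.le_rightDegree hv h
    _ ≤ _ := by
        rw [Finset.sum_add_distrib, Finset.sum_ite_eq']
        gcongr
        split_ifs <;> omega

/-- Right extensions do not preserve the ending `x`, so the bound is transferred through left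
degrees: discarding the words not ending in `x` cannot increase the total deficit. -/
theorem SecondOccurrenceFlips.card_add_card_repeatedEnding_le {s : ℕ → Bool}
    (hs : SecondOccurrenceFlips s) {n k : ℕ} {x : Word} (hx : x.length ≤ k) :
    (factorsEnding s n x k).card + (repeatedEnding s n x k).card ≤
      (factorsEnding s n x (k + 1)).card + 2 := by
  have h := hs.card_add_card_repeatedEnding_nil_le n k
  rw [card_factorsEnding_succ (Nat.zero_le k), card_factorsEnding_add_card_repeatedEnding] at h
  rw [card_factorsEnding_succ hx, card_factorsEnding_add_card_repeatedEnding]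
  have hsub : factorsEnding s n x k ⊆ factorsEnding s n [] k := fun u hu =>
    mem_factorsEnding.mpr ⟨(mem_factorsEnding.mp hu).1, List.nil_suffix⟩
  rw [← Finset.sum_sdiff hsub, ← Finset.sum_sdiff hsub] at h
  have := Finset.sum_le_sum (s := factorsEnding s n [] k \ factorsEnding s n x k)
    fun v _ => leftDegree_le (s := s) (n := n) (v := v)
  omega

theorem card_factorsEnding_length_le_one (s : ℕ → Bool) (n : ℕ) (x : Word) :
    (factorsEnding s n x x.length).card ≤ 1 := by
  have key : ∀ u ∈ factorsEnding s n x x.length, x = u := fun u hu =>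
    (mem_factorsEnding.mp hu).2.eq_of_length (length_of_mem_factorsEnding hu).symm
  exact Finset.card_le_one.mpr fun u hu v hv => (key u hu).symm.trans (key v hv)

theorem card_factorsEnding_le_sum (s : ℕ → Bool) (n : ℕ) (x : Word) (r : ℕ) :
    (factorsEnding s n x (x.length + r)).card ≤
      1 + ∑ t ∈ Finset.range r, (repeatedEnding s n x (x.length + t)).card := by
  induction r with
  | zero => simpa using card_factorsEnding_length_le_one s n x
  | succ r ih =>
    rw [Finset.sum_range_succ]
    have := card_factorsEnding_succ_le (s := s) (n := n) (x := x) (k := x.length + r) (by omega)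
    rw [← add_assoc]
    omega

theorem SecondOccurrenceFlips.sum_le_card_factorsEnding {s : ℕ → Bool}
    (hs : SecondOccurrenceFlips s) (n : ℕ) (x : Word) (r : ℕ) :
    ∑ t ∈ Finset.range r, (repeatedEnding s n x (x.length + t)).card ≤
      (factorsEnding s n x (x.length + r)).card + 2 * r := by
  induction r with
  | zero => simp
  | succ r ih =>
    rw [Finset.sum_range_succ]
    have := hs.card_add_card_repeatedEnding_le (n := n) (x := x) (k := x.length + r) (by omega)
    rw [← add_assoc]
    omega

theorem fac_suffix_iff {s : ℕ → Bool} {i r : ℕ} {x : Word} :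
    x <:+ fac s i (r + x.length) ↔ fac s (i + r) x.length = x := by
  rw [fac_add]
  constructor
  · intro h
    exact (List.suffix_of_suffix_length_le (List.suffix_append _ _) h (by simp)).eq_of_length
      (by simp)
  · intro h
    rw [h]
    exact List.suffix_append _ _

theorem card_factorsEnding_le_card_positions (s : ℕ → Bool) (n : ℕ) (x : Word) (r : ℕ) :
    (factorsEnding s n x (x.length + r)).card ≤ (positions s n x).card := by
  rw [add_comm]
  refine Finset.card_le_card_of_surjOn (fun j => fac s (j - r) (r + x.length)) fun u hu => ?_
  obtain ⟨⟨i, hi, rfl⟩, hx⟩ := mem_factorsEnding.mp hu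
  exact ⟨i + r, mem_positions.mpr ⟨by omega, fac_suffix_iff.mp hx⟩, by simp⟩

/-- Extending each occurrence of `x` by `r` letters to the left gives words too long to repeat,
hence distinct; at most `r` occurrences start too early for this. -/
theorem card_positions_le {s : ℕ → Bool} {n r : ℕ} {x : Word}
    (h : ∀ u : Word, 2 ≤ (positions s n u).card → u.length < x.length + r) :
    (positions s n x).card ≤ (factorsEnding s n x (x.length + r)).card + r := by
  have h1 : positions s n x ⊆
      ((positions s n x).filter fun j => r ≤ j) ∪ Finset.range r := by
    intro j hj
    simp only [Finset.mem_union, Finset.mem_filter, Finset.mem_range]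
    rcases le_or_gt r j with h | h
    · exact Or.inl ⟨hj, h⟩
    · exact Or.inr h
  have h2 : ((positions s n x).filter fun j => r ≤ j).card ≤
      (factorsEnding s n x (x.length + r)).card := by
    rw [add_comm x.length r] at h ⊢
    refine Finset.card_le_card_of_injOn (fun j => fac s (j - r) (r + x.length)) ?_ ?_
    · intro j hj
      obtain ⟨hj, hr⟩ := Finset.mem_filter.mp hj
      obtain ⟨hj1, hj2⟩ := mem_positions.mp hj
      refine mem_factorsEnding.mpr ⟨⟨j - r, by omega, rfl⟩, fac_suffix_iff.mpr ?_⟩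
      rwa [Nat.sub_add_cancel hr]
    · intro j hj j' hj' heq
      obtain ⟨hj, hr⟩ := Finset.mem_filter.mp hj
      obtain ⟨hj', hr'⟩ := Finset.mem_filter.mp hj'
      have hj1 := (mem_positions.mp hj).1
      have hj1' := (mem_positions.mp hj').1
      by_contra hne
      have := h (fac s (j - r) (r + x.length)) (Finset.one_lt_card.mpr
        ⟨j - r, fac_mem_positions.mpr ⟨by omega, rfl⟩, j' - r,
          fac_mem_positions.mpr ⟨by omega, heq.symm⟩, by omega⟩)
      simp at this
  calc _ ≤ _ := Finset.card_le_card h1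
    _ ≤ _ := Finset.card_union_le _ _
    _ ≤ _ := by rw [Finset.card_range]; omega

/-! ### The asymptotic estimate -/

theorem ncard_REnd {n r : ℕ} {x : Word}
    (h : ∀ u : Word, 2 ≤ (positions bit n u).card → u.length < x.length + r) :
    (REnd n x).ncard =
      ∑ t ∈ Finset.range r, (repeatedEnding bit n x (x.length + t)).card := by
  have hset : REnd n x = ((Finset.range r).biUnion fun t =>
      repeatedEnding bit n x (x.length + t) : Finset Word) := by
    ext u
    simp only [REnd, R, Set.mem_ofPred_eq, occ_initSeg, Finset.coe_biUnion, Set.mem_iUnion,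
      Finset.mem_coe, mem_repeatedEnding, Finset.mem_range, exists_prop]
    constructor
    · rintro ⟨h2, hx⟩
      have := h u h2
      have := hx.length_le
      exact ⟨u.length - x.length, by omega, by omega, hx, h2⟩
    · rintro ⟨t, -, -, hx, h2⟩
      exact ⟨h2, hx⟩
  rw [hset, Set.ncard_coe_finset, Finset.card_biUnion]
  intro t _ t' _ hne
  refine Finset.disjoint_left.mpr fun u hu hu' => hne ?_
  have := (mem_repeatedEnding.mp hu).1
  have := (mem_repeatedEnding.mp hu').1
  omega

theorem abs_ncard_REnd_sub_N_le {n r : ℕ} {x : Word}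
    (h : ∀ u : Word, 2 ≤ (positions bit n u).card → u.length < x.length + r) :
    |((REnd n x).ncard : ℝ) - (N n x : ℝ)| ≤ 2 * r + 1 := by
  rw [ncard_REnd h, N, occ_initSeg]
  have h1 := card_factorsEnding_le_sum bit n x r
  have h2 := bit_secondOccurrenceFlips.sum_le_card_factorsEnding n x r
  have h3 := card_factorsEnding_le_card_positions bit n x r
  have h4 := card_positions_le h
  generalize ∑ t ∈ Finset.range r, (repeatedEnding bit n x (x.length + t)).card = a at *
  generalize (positions bit n x).card = b at *
  have h5 : a ≤ b + 2 * r := by omega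
  have h6 : b ≤ a + r + 1 := by omega
  have h5' : (a : ℝ) ≤ b + 2 * r := by exact_mod_cast h5
  have h6' : (b : ℝ) ≤ a + r + 1 := by exact_mod_cast h6
  rw [abs_le]
  constructor <;> nlinarith [(Nat.cast_nonneg r : (0 : ℝ) ≤ r)]

theorem ncard_REnd_sub_N_isLittleO (x : Word) :
    (fun n : ℕ => ((REnd n x).ncard : ℝ) - (N n x : ℝ)) =o[atTop] (fun n : ℕ => (n : ℝ)) := by
  rw [isLittleO_iff]
  intro ε hε
  -- With r = 4 * (n / (4 * D)) ≤ n / D and `n ≥ D`, the error 2r + 1 is at most 3n / D ≤ εn.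
  obtain ⟨D, hD⟩ := exists_nat_gt (3 / ε)
  have hD0 : (0 : ℝ) < D := (div_pos three_pos hε).trans hD
  have hDpos : 0 < D := by exact_mod_cast hD0
  filter_upwards [eventually_ge_atTop ((8 * D * (16 * D + 8)) * (4 * D)), eventually_ge_atTop D]
    with n hn hnD
  have hlen : ∀ u : Word, 2 ≤ (positions bit n u).card →
      u.length < x.length + 4 * (n / (4 * D)) := by
    intro u hu
    have := bit_secondOccurrenceFlips.length_repeated_lt hDpos
      ((Nat.le_div_iff_mul_le (by omega)).mpr hn) hu
    omega
  have h1 := abs_ncard_REnd_sub_N_le hlen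
  have h2 : 4 * (n / (4 * D)) * D ≤ n := by
    have := Nat.div_mul_le_self n (4 * D)
    nlinarith
  have h2' : ((4 * (n / (4 * D)) : ℕ) : ℝ) * D ≤ n := by exact_mod_cast h2
  have hnD' : (D : ℝ) ≤ n := by exact_mod_cast hnD
  rw [Real.norm_eq_abs, Real.norm_eq_abs, Nat.abs_cast]
  refine h1.trans ?_
  rw [div_lt_iff₀ hε] at hD
  generalize ((4 * (n / (4 * D)) : ℕ) : ℝ) = y at *
  have h3 : (2 * y + 1) * D ≤ 3 * n := by nlinarith
  have hn0 : (0 : ℝ) ≤ n := Nat.cast_nonneg n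
  have h4 : 3 * (n : ℝ) ≤ (ε * n) * D := by nlinarith
  exact le_of_mul_le_mul_right (h3.trans h4) hD0

/-! ### The tree -/

theorem tail_mem_R {n : ℕ} {a : Bool} {v : Word} (h : a :: v ∈ R n) : v ∈ R n := by
  simp only [R, Set.mem_ofPred_eq, occ_initSeg] at h ⊢
  refine h.trans (Finset.card_le_card_of_injOn (· + 1) (fun i hi => ?_)
    (add_left_injective 1).injOn)
  obtain ⟨h1, h2⟩ := mem_positions.mp hi
  rw [List.length_cons, fac_succ, List.cons.injEq] at h2
  rw [List.length_cons] at h1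
  exact mem_positions.mpr ⟨by simp only; omega, h2.2⟩

theorem exists_isPath_to_root {n : ℕ} (v : Word) (hv : v ∈ R n) :
    ∃ r : R n, r.1 = [] ∧ ∃ p : (T n).Walk ⟨v, hv⟩ r, p.IsPath := by
  classical
  suffices h : ∃ r : R n, r.1 = [] ∧ (T n).Reachable ⟨v, hv⟩ r by
    obtain ⟨r, hr, ⟨p⟩⟩ := h
    exact ⟨r, hr, p.toPath.1, p.toPath.2⟩
  induction v with
  | nil => exact ⟨⟨[], hv⟩, rfl, SimpleGraph.Reachable.refl _⟩
  | cons a v ih =>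
    obtain ⟨r, hr, h⟩ := ih (tail_mem_R hv)
    have hadj : (T n).Adj ⟨a :: v, hv⟩ ⟨v, tail_mem_R hv⟩ := Or.inl ⟨a, rfl⟩
    exact ⟨r, hr, hadj.reachable.trans h⟩

/-- A walk to the root visits all suffixes of its starting word. -/
theorem mem_support_of_suffix {n : ℕ} {u r w : R n} (hr : r.1 = []) (p : (T n).Walk u r)
    (h : w.1 <:+ u.1) : w ∈ p.support := by
  induction p with
  | nil =>
    rw [hr, List.suffix_nil] at h
    simp [Subtype.ext_iff, h, hr]
  | @cons u u' r hadj p ih =>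
    rw [SimpleGraph.Walk.support_cons, List.mem_cons]
    rcases hadj with ⟨a, ha⟩ | ⟨a, ha⟩
    · rw [ha] at h
      rcases List.suffix_cons_iff.mp h with h | h
      · exact Or.inl (Subtype.ext (h.trans ha.symm))
      · exact Or.inr (ih hr h)
    · exact Or.inr (ih hr (by rw [ha]; exact h.trans (List.suffix_cons a _)))

theorem labelWord_of_isPath {n : ℕ} {u r : R n} (hr : r.1 = []) (p : (T n).Walk u r)
    (hp : p.IsPath) : labelWord p = u.1 := by
  induction p with
  | nil => rw [hr]; rfl
  | @cons u u' r hadj p ih =>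
    rw [SimpleGraph.Walk.cons_isPath_iff] at hp
    have hl : labelWord (SimpleGraph.Walk.cons hadj p) = edgeLabel u.1 u'.1 :: labelWord p := by
      simp [labelWord]
    rw [hl, ih hr hp.1]
    rcases id hadj with ⟨a, ha⟩ | ⟨a, ha⟩
    · simp [edgeLabel, ha]
    -- A first step away from the root would force the rest of the walk back through `u`, so it is
    -- no path.
    · exact absurd (mem_support_of_suffix hr p (by rw [ha]; exact List.suffix_cons a _)) hp.2

theorem image_verts_TEnd (n : ℕ) (x : Word) : Subtype.val '' (TEnd n x).verts = REnd n x := by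
  ext v
  constructor
  · rintro ⟨v, ⟨r, hr, p, hp, hx⟩, rfl⟩
    rw [labelWord_of_isPath hr p hp] at hx
    exact ⟨v.2, hx⟩
  · rintro ⟨hv, hx⟩
    obtain ⟨r, hr, p, hp⟩ := exists_isPath_to_root v hv
    exact ⟨⟨v, hv⟩, ⟨r, hr, p, hp, by rwa [labelWord_of_isPath hr p hp]⟩, rfl⟩

theorem ncard_verts_TEnd (n : ℕ) (x : Word) : (TEnd n x).verts.ncard = (REnd n x).ncard := by
  rw [← image_verts_TEnd, Set.ncard_image_of_injective _ Subtype.val_injective]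

end EM

theorem theorem1 (x : EM.Word) :
    (∀ n : ℕ, 1 ≤ n → (EM.TEnd n x).verts.ncard = (EM.REnd n x).ncard) ∧
      (fun n : ℕ => ((EM.REnd n x).ncard : ℝ) - (EM.N n x : ℝ)) =o[atTop]
        (fun n : ℕ => (n : ℝ)) :=
  ⟨fun n _ => EM.ncard_verts_TEnd n x, EM.ncard_REnd_sub_N_isLittleO x⟩
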